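/- **Conventions.** A valuation $v$ of a field $K$ is a real discrete valuation, i.e. a map of $K$ onto $\mathbb Z\cup\{\infty\}$ with $v(a)=\infty\Leftrightarrow a=0$, $v(ab)=v(a)+v(b)$ and $v(a+b)\ge\min(v(a),v(b))$. A valuation $w$ of an overfield $\hat K$ of $K$ extends $v$ if the valuation ring of $w$ intersected with $K$ is the valuation ring of $v$; if it does, the reduced ramification exponent $\bar r(w:v)$ is the unique positive integer with $w(a)=\bar r(w:v)\,v(a)$ for all $a\in K$. **Fourth Irreducibility Lemma.** Let $p$ be a prime number and $t$ a positive integer. For $0\le i\le t$ let $f_i(Y)$ and $g_i(Y)$ be monic polynomials of degree $p+t-i$ in $Y$ with coefficients in a field $K_i$, such that $g_i$ is obtained from $f_i$ by one or more of the three operations of multiplying the roots by a nonzero quantity $c\in K_i$ (replacing $f(Y)$ of degree $n$ by $c^nf(Y/c)$), reciprocating the roots, provided zero is not a root (replacing $f(Y)$ by $f(0)^{-1}Y^nf(1/Y)$), and decreasing the roots by a quantity $c\in K_i$ (replacing $f(Y)$ by $f(Y+c)$). For $1\le i\le t$ assume that $f_i$ is obtained by throwing away a root $\alpha_i$ of $g_{i-1}$,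 i.e. $g_{i-1}(Y)=(Y-\alpha_i)f_i(Y)$, and that $K_i=K_{i-1}(\alpha_i)$. Assume that $f_0$ has no multiple roots in any field extension of $K_0$. Let $\hat u^{(i)}$ and $u^{(i)}$ be valuations of $K_i$ for $0\le i\le t$ such that $\hat u^{(0)}=u^{(0)}$; for $1\le i\le t$, $\hat u^{(i)}$ extends $\hat u^{(i-1)}$ and $u^{(i)}$ extends $u^{(i-1)}$; $p\nmid\bar r(\hat u^{(i)}:\hat u^{(i-1)})$ for every $i$ with $1\le i\le t$; and $p\mid\bar r(u^{(j)}:u^{(j-1)})$ for some $j$ with $1\le j\le t$. Let $u'$ be an extension of $u^{(t)}$ to a splitting field $K'$ of $g_t$ over $K_t$, and let $r'=\bar r(u':u^{(t)})$ and $r^*=\prod_{i=1}^t\bar r(u^{(i)}:u^{(i-1)})$. Then: 1. The polynomial $g_t(Y)$ is irreducible in $K_t[Y]$. 2. $|\operatorname{Gal}(g_t,K_t)|$ is divisible by $r'$. 3. The valuation $u^{(t-1)}$ has only finitely many extensions $u^{(t)}_1=u^{(t)},u^{(t)}_2,\dots,u^{(t)}_\delta$ to $K_t$; and with $$r''=\frac{\operatorname{LCM}\bigl(\bar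 r(u^{(t)}_1:u^{(t-1)}),\dots,\bar r(u^{(t)}_\delta:u^{(t-1)})\bigr)}{\bar r(u^{(t)}:u^{(t-1)})},$$ $r'$ is divisible by $r''$. 4. If moreover $g_{t-1}(Y)$ is irreducible in $K_{t-1}[Y]$, the residue field of $u^{(0)}$ is an algebraically closed field of the same characteristic as $K_0$, and $\bar r(u^{(t)}_j:u^{(t-1)})\not\equiv0\pmod{\operatorname{char}K_0}$ for $1\le j\le\delta$ (an empty condition if $\operatorname{char}K_0=0$), then $r'=r''$. 5. For any valuations $\bar u^{(0)},\dots,\bar u^{(t)},\bar u'$ of $K_0,\dots,K_t,K'$ respectively such that $\bar u^{(0)}=u^{(0)}$, $\bar u^{(i)}$ extends $\bar u^{(i-1)}$ for $1\le i\le t$, and $\bar u'$ extends $\bar u^{(t)}$, upon letting $\bar r^*=\prod_{i=1}^t\bar r(\bar u^{(i)}:\bar u^{(i-1)})$ and $\bar r'=\bar r(\bar u':\bar u^{(t)})$ we have $\bar r^*\bar r'=r^*r'$. -/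

import Mathlib

open Polynomial
open scoped WithZero IntermediateField

/-- One of the three basic transformations of the roots of a polynomial over a field `F`. -/
inductive RootTransform {F : Type*} [Field F] : F[X] → F[X] → Prop
  /-- Multiply the roots by `c ≠ 0`: `f(Y)` becomes `c ^ n f(Y / c)` with `n = deg f`. -/
  | scale (f : F[X]) (c : F) (hc : c ≠ 0) : RootTransform f (f.scaleRoots c)
  /-- Reciprocate the roots, zero not being a root: `f(Y)` becomes `Y ^ n f(1 / Y) / f(0)`. -/
  | reciprocate (f : F[X]) (h0 : f.coeff 0 ≠ 0) : RootTransform f (C (f.coeff 0)⁻¹ * f.reverse)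
  /-- Decrease the roots by `c`: `f(Y)` becomes `f(Y + c)`. -/
  | decrease (f : F[X]) (c : F) : RootTransform f (f.comp (X + C c))

/-- Real discrete valuations of a field with value group exactly `ℤ`, written multiplicatively:
the additive value of `a` is the integer `n` with `v a = exp (-n)`, and `v 0 = 0` stands for the
additive value `∞`. -/
abbrev DiscVal (F : Type*) [Field F] : Type _ :=
  {v : Valuation F ℤᵐ⁰ // Function.Surjective v}

/-- The residue field of a valuation: its valuation ring modulo the maximal ideal. -/
abbrev DiscVal.Residue {F : Type*} [Field F] (v : DiscVal F) : Type _ :=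
  IsLocalRing.ResidueField v.1.valuationSubring

/-- `w` extends `v` along the embedding `φ`: the valuation ring of `w` intersected with the
smaller field is the valuation ring of `v`. -/
def DiscVal.IsExtension {F E : Type*} [Field F] [Field E] (φ : F →+* E)
    (v : DiscVal F) (w : DiscVal E) : Prop :=
  w.1.valuationSubring.comap φ = v.1.valuationSubring

/-- The reduced ramification exponent of an extension `w` of `v`: the unique positive integer
`e` with (additively) `w a = e * v a` for all `a` in the smaller field. -/
noncomputable def DiscVal.ramExp {F E : Type*} [Field F] [Field E] (φ : F →+* E)
    (v : DiscVal F) (w : DiscVal E) : ℕ :=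
  sInf {e : ℕ | 0 < e ∧ ∀ a : F, w.1 (φ a) = v.1 a ^ e}

/-- For an extension of valuations exactly one `e` qualifies in the definition of `ramExp`. -/
theorem DiscVal.existsUnique_ramExp {F E : Type*} [Field F] [Field E] (φ : F →+* E)
    (v : DiscVal F) (w : DiscVal E) (h : DiscVal.IsExtension φ v w) :
    ∃! e : ℕ, 0 < e ∧ ∀ a : F, w.1 (φ a) = v.1 a ^ e := by
  have hle : ∀ a : F, w.1 (φ a) ≤ 1 ↔ v.1 a ≤ 1 := by
    intro a
    have := congrArg (fun S : ValuationSubring F => a ∈ S) h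
    simpa [ValuationSubring.mem_comap, Valuation.mem_valuationSubring_iff] using this
  obtain ⟨π, hπ⟩ := v.2 (WithZero.exp (1 : ℤ))
  have hπ0 : π ≠ 0 := by
    rintro rfl
    rw [map_zero] at hπ
    exact WithZero.exp_ne_zero hπ.symm
  have hφ0 : w.1 (φ π) ≠ 0 := by
    simpa using hπ0
  have hgt : 1 < w.1 (φ π) := by
    rw [← not_le, hle, hπ, not_le, ← WithZero.exp_zero, WithZero.exp_lt_exp]
    norm_num
  obtain ⟨m, hm⟩ : ∃ m : ℤ, w.1 (φ π) = WithZero.exp m :=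
    ⟨WithZero.log (w.1 (φ π)), (WithZero.exp_log hφ0).symm⟩
  have hm0 : 0 < m := by
    rwa [hm, ← WithZero.exp_zero, WithZero.exp_lt_exp] at hgt
  obtain ⟨e, rfl⟩ := Int.eq_ofNat_of_zero_le hm0.le
  have hone : ∀ a : F, v.1 a = 1 → w.1 (φ a) = 1 := by
    intro a ha
    refine le_antisymm ((hle a).2 ha.le) ?_
    have h2 := (hle a⁻¹).2 (by simp [ha])
    have ha0 : a ≠ 0 := by
      rintro rfl
      simp at ha
    have hpos : 0 < w.1 (φ a) := by
      rw [zero_lt_iff]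
      simpa using ha0
    rw [map_inv₀, map_inv₀] at h2
    exact (inv_le_one₀ hpos).1 h2
  refine ⟨e, ⟨by exact_mod_cast hm0, ?_⟩, ?_⟩
  · intro a
    by_cases ha : a = 0
    · subst ha
      have : e ≠ 0 := by
        rintro rfl
        simp at hm0
      simp [this]
    · have hva : v.1 a ≠ 0 := by simpa using ha
      obtain ⟨n, hn⟩ : ∃ n : ℤ, v.1 a = WithZero.exp n :=
        ⟨WithZero.log (v.1 a), (WithZero.exp_log hva).symm⟩
      have h1 := hone (a * π ^ (-n)) (by
        rw [map_mul, map_zpow₀, hn, hπ, ← WithZero.exp_zsmul, ← WithZero.exp_add]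
        simp)
      rw [map_mul, map_zpow₀, map_mul, map_zpow₀, zpow_neg,
        mul_inv_eq_one₀ (zpow_ne_zero _ hφ0)] at h1
      rw [h1, hm, hn, ← WithZero.exp_zsmul, ← WithZero.exp_nsmul]
      congr 1
      simp [mul_comm]
  · rintro e' ⟨-, he'⟩
    have := he' π
    rw [hm, hπ, ← WithZero.exp_nsmul, WithZero.exp_inj] at this
    simpa using this.symm

/-- The set of all extensions of `v` along the embedding `φ`. -/
def DiscVal.extensions {F E : Type*} [Field F] [Field E] (φ : F →+* E) (v : DiscVal F) :
    Set (DiscVal E) :=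
  {w | DiscVal.IsExtension φ v w}

/-! Transforming roots does not affect whether a polynomial splits over an overfield, and each
discarded root is adjoined to the next field. Hence `L` is a splitting field of `f 0` over `K 0` and
of every `g s` over `K s` (`isSplittingField_of_chain`), and it is Galois over `K 0` because `f 0`
is separable.

In a Galois extension all extensions of a discrete valuation have the same exponent
(`ramExp_eq_of_isGalois`), so multiplicativity in towers makes the total exponent of any chain from
`u 0` up to `L` the same. It is divisible by `p` along `u`, hence along `uhat`; there `p` can only
come from the last step, from `K t` to `L`. So `p` divides the order of `Gal(L/K t)`, and Cauchy's
theorem makes the degree `p` polynomial `g t` irreducible (`irreducible_of_prime_dvd_card_gal`).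

The claims on `r''` concern the tower from `K (t - 1)` through `K t` to `L` (`exists_lcm_div`). Each
exponent in `K t` divides the common exponent in `L`, hence so does their LCM. Equality is
Abhyankar's lemma (`card_decompositionGroup_dvd`): with trivial residue extensions, decomposition
groups have order equal to the ramification exponent; tameness puts the wild groups into `Gal(L/K
t)`, which has trivial core when `g (t - 1)` is irreducible. So decomposition groups are cyclic, and
the LCM kills them. -/

namespace DiscVal

/-! ### Extensions, exponents and restriction of discrete valuations. -/

section Basic

variable {F E M : Type*} [Field F] [Field E] [Field M] {φ : F →+* E} {ψ : E →+* M}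
  {v : DiscVal F} {w : DiscVal E} {x : DiscVal M}

theorem isExtension_iff :
    IsExtension φ v w ↔ ∀ a, w.1 (φ a) ≤ 1 ↔ v.1 a ≤ 1 := by
  simp [IsExtension, ValuationSubring.ext_iff, ValuationSubring.mem_comap,
    Valuation.mem_valuationSubring_iff]

theorem ramExp_spec (h : IsExtension φ v w) :
    0 < ramExp φ v w ∧ ∀ a, w.1 (φ a) = v.1 a ^ ramExp φ v w :=
  Nat.sInf_mem (s := {e : ℕ | 0 < e ∧ ∀ a : F, w.1 (φ a) = v.1 a ^ e})
    (existsUnique_ramExp φ v w h).exists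

theorem ramExp_pos (h : IsExtension φ v w) : 0 < ramExp φ v w := (ramExp_spec h).1

theorem isExtension_of_forall_eq_pow {e : ℕ} (he : 0 < e) (h : ∀ a, w.1 (φ a) = v.1 a ^ e) :
    IsExtension φ v w := by
  rw [isExtension_iff]
  intro a
  rw [h, pow_le_one_iff he.ne']

theorem ramExp_eq {e : ℕ} (he : 0 < e) (h : ∀ a, w.1 (φ a) = v.1 a ^ e) :
    ramExp φ v w = e :=
  have hext := isExtension_of_forall_eq_pow he h
  (existsUnique_ramExp φ v w hext).unique (ramExp_spec hext) ⟨he, h⟩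

theorem exists_uniformizer (v : DiscVal F) :
    ∃ π : F, v.1 π = WithZero.exp (-1 : ℤ) ∧ π ≠ 0 := by
  obtain ⟨π, hπ⟩ := v.2 (WithZero.exp (-1 : ℤ))
  refine ⟨π, hπ, ?_⟩
  rintro rfl
  rw [map_zero] at hπ
  exact WithZero.exp_ne_zero hπ.symm

theorem exp_neg_one_lt_one : WithZero.exp (-1 : ℤ) < 1 := by
  rw [← WithZero.exp_zero, WithZero.exp_lt_exp]
  norm_num

/-- The exponent relating the two valuations divides 1, since both have value group all of ℤ. -/
theorem ext_of_valuationSubring_eq {v w : DiscVal F}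
    (h : v.1.valuationSubring = w.1.valuationSubring) : v = w := by
  have hext : IsExtension (RingHom.id F) v w := h.symm
  obtain ⟨he, hs⟩ := ramExp_spec hext
  set e := ramExp (RingHom.id F) v w
  obtain ⟨π, hπ, hπ0⟩ := exists_uniformizer w
  have h1 := hs π
  have hv0 : v.1 π ≠ 0 := by simpa using hπ0
  obtain ⟨n, hn⟩ : ∃ n : ℤ, v.1 π = WithZero.exp n :=
    ⟨WithZero.log (v.1 π), (WithZero.exp_log hv0).symm⟩
  rw [RingHom.id_apply, hπ, hn, ← WithZero.exp_nsmul, WithZero.exp_inj, nsmul_eq_mul] at h1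
  have he1 : e = 1 := by
    have : (e : ℤ) ∣ 1 := ⟨-n, by linarith⟩
    exact_mod_cast Int.eq_one_of_dvd_one (by positivity) this
  refine Subtype.ext (Valuation.ext fun a => ?_)
  have := hs a
  rw [he1, pow_one] at this
  exact this.symm

theorem IsExtension.trans (h₁ : IsExtension φ v w) (h₂ : IsExtension ψ w x) :
    IsExtension (ψ.comp φ) v x := by
  rw [isExtension_iff] at *
  intro a
  rw [RingHom.comp_apply, h₂, h₁]

theorem ramExp_comp (h₁ : IsExtension φ v w) (h₂ : IsExtension ψ w x) :
    ramExp (ψ.comp φ) v x = ramExp φ v w * ramExp ψ w x := by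
  refine ramExp_eq (Nat.mul_pos (ramExp_pos h₁) (ramExp_pos h₂)) fun a => ?_
  rw [RingHom.comp_apply, (ramExp_spec h₂).2, (ramExp_spec h₁).2, pow_mul]

theorem IsExtension.of_comp (h₁ : IsExtension (ψ.comp φ) v x) (h₂ : IsExtension ψ w x) :
    IsExtension φ v w := by
  rw [isExtension_iff] at *
  intro a
  rw [← h₂, ← h₁, RingHom.comp_apply]

theorem IsExtension.lt_one_iff (h : IsExtension φ v w) (a : F) : w.1 (φ a) < 1 ↔ v.1 a < 1 := by
  rw [(ramExp_spec h).2, pow_lt_one_iff (ramExp_pos h).ne']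

/-- The value group is a nonzero subgroup nℤ; dividing by |n| normalizes it. This is needed because
a restricted valuation need not be onto ℤ. -/
theorem exists_pow_eq (V : Valuation F ℤᵐ⁰) (hV : ∃ a, a ≠ 0 ∧ V a ≠ 1) :
    ∃ (w : DiscVal F) (e : ℕ), 0 < e ∧ ∀ a, V a = w.1 a ^ e := by
  classical
  let S : AddSubgroup ℤ :=
    { carrier := {n | ∃ a, V a = WithZero.exp n}
      zero_mem' := ⟨1, by simp⟩
      add_mem' := by
        rintro m n ⟨a, ha⟩ ⟨b, hb⟩
        exact ⟨a * b, by rw [map_mul, ha, hb, WithZero.exp_add]⟩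
      neg_mem' := by
        rintro m ⟨a, ha⟩
        exact ⟨a⁻¹, by rw [map_inv₀, ha, WithZero.exp_neg]⟩ }
  obtain ⟨n, hn⟩ := Int.subgroup_cyclic S
  rw [← AddSubgroup.zmultiples_eq_closure] at hn
  have hval : ∀ a, a ≠ 0 → ∃ k : ℤ, V a = WithZero.exp (k * n) := by
    intro a ha
    have h0 : V a ≠ 0 := by simpa using ha
    have hm : WithZero.log (V a) ∈ S := ⟨a, (WithZero.exp_log h0).symm⟩
    rw [hn, AddSubgroup.mem_zmultiples_iff] at hm
    obtain ⟨k, hk⟩ := hm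
    refine ⟨k, ?_⟩
    rw [← WithZero.exp_log h0, ← hk, smul_eq_mul]
  have hn0 : n ≠ 0 := by
    rintro rfl
    obtain ⟨a, ha, h1⟩ := hV
    obtain ⟨k, hk⟩ := hval a ha
    simp at hk
    exact h1 hk
  set e := n.natAbs with he
  have he0 : 0 < e := Int.natAbs_pos.2 hn0
  have hval' : ∀ a, ∃ y : ℤᵐ⁰, V a = y ^ e := by
    intro a
    by_cases ha : a = 0
    · exact ⟨0, by simp [ha, he0.ne']⟩
    · obtain ⟨k, hk⟩ := hval a ha
      rcases Int.natAbs_eq n with h | h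
      · refine ⟨WithZero.exp k, ?_⟩
        rw [hk, ← WithZero.exp_nsmul, nsmul_eq_mul, mul_comm]
        congr 2
      · refine ⟨WithZero.exp (-k), ?_⟩
        rw [hk, ← WithZero.exp_nsmul, nsmul_eq_mul, he]
        congr 1
        rw [h]; simp [mul_comm]
  -- Taking `e`-th powers is injective and reflects the order, so the valuation axioms for `W`
  -- reduce to those of `V`.
  have hinj : Function.Injective fun y : ℤᵐ⁰ => y ^ e :=
    fun y z h => (pow_left_inj₀ zero_le zero_le he0.ne').1 h
  choose W hW using hval'
  let w : Valuation F ℤᵐ⁰ :=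
    { toFun := W
      map_zero' := hinj (by simp [← hW, he0.ne'])
      map_one' := hinj (by simp [← hW])
      map_mul' := fun a b => hinj (by simp [mul_pow, ← hW])
      map_add_le_max' := fun a b => by
        rcases le_total (V a) (V b) with h | h
        · refine le_max_of_le_right (le_of_pow_le_pow_left₀ he0.ne' zero_le ?_)
          rw [← hW, ← hW]
          exact (V.map_add a b).trans (max_le h le_rfl)
        · refine le_max_of_le_left (le_of_pow_le_pow_left₀ he0.ne' zero_le ?_)
          rw [← hW, ← hW]
          exact (V.map_add a b).trans (max_le le_rfl h) }
  refine ⟨⟨w, fun y => ?_⟩, e, he0, hW⟩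
  by_cases hy : y = 0
  · exact ⟨0, by rw [hy, map_zero]⟩
  · have hm : WithZero.log y * e ∈ S := by
      rw [hn, AddSubgroup.mem_zmultiples_iff]
      rcases Int.natAbs_eq n with h | h
      · exact ⟨WithZero.log y, by rw [smul_eq_mul, he, ← h]⟩
      · exact ⟨-WithZero.log y, by rw [smul_eq_mul, he]; nth_rw 1 [h]; ring⟩
    obtain ⟨a, ha⟩ := hm
    refine ⟨a, hinj ?_⟩
    change W a ^ e = y ^ e
    rw [← hW, ha, mul_comm, ← nsmul_eq_mul, WithZero.exp_nsmul, WithZero.exp_log hy]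

theorem exists_restrict (h : IsExtension (ψ.comp φ) v x) :
    ∃ w : DiscVal E, IsExtension φ v w ∧ IsExtension ψ w x := by
  obtain ⟨π, hπ, hπ0⟩ := exists_uniformizer v
  obtain ⟨w, e, he, hw⟩ := exists_pow_eq (x.1.comap ψ) ⟨φ π, by simpa using hπ0, by
    have := (h.lt_one_iff π).2 (hπ ▸ exp_neg_one_lt_one)
    exact this.ne⟩
  have h2 : IsExtension ψ w x := isExtension_of_forall_eq_pow he hw
  exact ⟨w, h.of_comp h2, h2⟩

/-- The pullback of a discrete valuation along a field isomorphism. -/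
def comapEquiv (w : DiscVal E) (σ : F ≃+* E) : DiscVal F :=
  ⟨w.1.comap (σ : F →+* E), w.2.comp σ.surjective⟩

@[simp] theorem comapEquiv_apply (w : DiscVal E) (σ : F ≃+* E) (a : F) :
    (w.comapEquiv σ).1 a = w.1 (σ a) := rfl

end Basic

open scoped Pointwise
open IsDedekindDomain

/-! ### Extensions of a valuation as primes of the integral closure. -/

section Dedekind

variable {K L : Type*} [Field K] [Field L] [Algebra K L]

theorem isNontrivial (v : DiscVal K) : v.1.IsNontrivial := by
  obtain ⟨π, hπ, -⟩ := exists_uniformizer v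
  exact ⟨π, by rw [hπ]; exact WithZero.exp_ne_zero, by rw [hπ]; exact exp_neg_one_lt_one.ne⟩

instance isDiscreteValuationRing (v : DiscVal K) :
    IsDiscreteValuationRing v.1.valuationSubring :=
  have := isNontrivial v
  inferInstance

theorem mem_maximalIdeal_iff (v : DiscVal K) (a : v.1.valuationSubring) :
    a ∈ IsLocalRing.maximalIdeal v.1.valuationSubring ↔ v.1 a < 1 :=
  Valuation.mem_maximalIdeal_iff ..

/-- The maximal ideal of the valuation ring, as a point of the height one spectrum. -/
def maxSpec (v : DiscVal K) : HeightOneSpectrum v.1.valuationSubring :=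
  IsDiscreteValuationRing.maximalIdeal v.1.valuationSubring

theorem maxSpec_asIdeal (v : DiscVal K) :
    v.maxSpec.asIdeal = IsLocalRing.maximalIdeal v.1.valuationSubring := rfl

/-- The discrete valuation given by a height one prime of a Dedekind domain. -/
noncomputable def ofPrime {B : Type*} [CommRing B] [IsDedekindDomain B] [Algebra B L]
    [IsFractionRing B L] (P : HeightOneSpectrum B) : DiscVal L :=
  ⟨P.valuation L, P.valuation_surjective L⟩

/-- Elements outside `P` are units for `w`, so the ring of `w` contains the discrete valuation ring
at `P`, whose only proper overring is the whole field. -/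
theorem eq_ofPrime {B : Type*} [CommRing B] [IsDedekindDomain B] [Algebra B L]
    [IsFractionRing B L] (P : HeightOneSpectrum B) (w : DiscVal L)
    (h1 : ∀ b : B, w.1 (algebraMap B L b) ≤ 1)
    (h2 : ∀ b : B, w.1 (algebraMap B L b) < 1 → b ∈ P.asIdeal) : w = ofPrime P := by
  symm
  refine ext_of_valuationSubring_eq (ValuationSubring.eq_of_le_of_ne_top _ ?_ ?_)
  · intro x hx
    rw [Valuation.mem_valuationSubring_iff] at hx ⊢
    obtain ⟨n, d, hd⟩ := P.exists_primeCompl_mul_eq_of_integer x hx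
    have hd1 : w.1 (algebraMap B L d) = 1 :=
      le_antisymm (h1 _) (not_lt.1 fun h => d.2 (h2 _ h))
    have := h1 n
    rwa [← hd, map_mul, hd1, mul_one] at this
  · have := isNontrivial w
    simpa [Valuation.valuationSubring_eq_top_iff] using this

theorem ofPrime_maxSpec (v : DiscVal K) : ofPrime v.maxSpec = v := by
  symm
  refine eq_ofPrime _ _ (fun b => b.2) fun b hb => ?_
  rw [maxSpec_asIdeal, mem_maximalIdeal_iff]
  exact hb

variable (v : DiscVal K) {w : DiscVal L}

/-- The integral closure of a valuation ring in an extension field. -/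
abbrev ringOfIntegers (L : Type*) [Field L] [Algebra K L] (v : DiscVal K) : Type _ :=
  integralClosure v.1.valuationSubring L

variable {v} in
theorem IsExtension.le_one (h : IsExtension (algebraMap K L) v w) (b : ringOfIntegers L v) :
    w.1 (b : L) ≤ 1 := by
  obtain ⟨p, hp, hb⟩ := b.2
  by_contra hlt
  push Not at hlt
  have key : (b : L) ∈ w.1.valuationSubring := by
    have hv : w.1.Integers w.1.valuationSubring := Valuation.valuationSubring.integers w.1
    refine hv.mem_of_integral ?_
    let f : v.1.valuationSubring →+* w.1.valuationSubring :=
      ((algebraMap K L).comp v.1.valuationSubring.subtype).codRestrict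
        w.1.valuationSubring.toSubring (fun a => (isExtension_iff.1 h a).2 a.2)
    refine ⟨p.map f, hp.map f, ?_⟩
    rw [eval₂_map]
    exact hb
  exact absurd key hlt.not_ge

variable [FiniteDimensional K L] [Algebra.IsSeparable K L]

instance : IsFractionRing (ringOfIntegers L v) L :=
  integralClosure.isFractionRing_of_finite_extension K L

instance : IsDedekindDomain (ringOfIntegers L v) :=
  integralClosure.isDedekindDomain v.1.valuationSubring K L

instance : Module.Finite v.1.valuationSubring (ringOfIntegers L v) :=
  IsIntegralClosure.finite v.1.valuationSubring K L (ringOfIntegers L v)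

-- The prime is the center of `w`: the integral elements of value below 1.
variable {v} in
theorem IsExtension.exists_eq_ofPrime (h : IsExtension (algebraMap K L) v w) :
    ∃ P : HeightOneSpectrum (ringOfIntegers L v), w = ofPrime P ∧
      P.asIdeal.LiesOver v.maxSpec.asIdeal := by
  let I : Ideal (ringOfIntegers L v) :=
    { carrier := {b | w.1 (b : L) < 1}
      zero_mem' := by simp
      add_mem' := fun {a b} ha hb => w.1.map_add_lt ha hb
      smul_mem' := fun c b hb => by
        change w.1 ((c : L) * b) < 1
        rw [map_mul]
        exact (mul_le_of_le_one_left zero_le (h.le_one c)).trans_lt hb }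
  have hI : ∀ b, b ∈ I ↔ w.1 (b : L) < 1 := fun _ => Iff.rfl
  have hprime : I.IsPrime := by
    refine ⟨?_, ?_⟩
    · rw [Ne, Ideal.eq_top_iff_one, hI]
      simp
    · intro a b hab
      rw [hI] at hab ⊢
      rw [hI]
      by_contra hcon
      push Not at hcon
      have ha := le_antisymm (h.le_one a) hcon.1
      have hb := le_antisymm (h.le_one b) hcon.2
      simp [ha, hb] at hab
  have hunder : I.LiesOver v.maxSpec.asIdeal := by
    refine ⟨Ideal.ext fun a => ?_⟩
    rw [maxSpec_asIdeal, mem_maximalIdeal_iff, Ideal.mem_comap, hI]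
    exact (h.lt_one_iff (a : K)).symm
  have hbot : I ≠ ⊥ := Ideal.ne_bot_of_liesOver_of_ne_bot v.maxSpec.ne_bot I
  exact ⟨⟨I, hprime, hbot⟩, eq_ofPrime _ w h.le_one fun b hb => hb, hunder⟩

theorem isExtension_ofPrime (P : HeightOneSpectrum (ringOfIntegers L v))
    [hP : P.asIdeal.LiesOver v.maxSpec.asIdeal] :
    IsExtension (algebraMap K L) v (ofPrime P) ∧
      ramExp (algebraMap K L) v (ofPrime P) = P.asIdeal.ramificationIdx v.1.valuationSubring := by
  have h1 : ∀ a, (ofPrime P : DiscVal L).1 (algebraMap K L a) =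
      v.1 a ^ (P.asIdeal.ramificationIdx v.1.valuationSubring) := by
    intro a
    rw [← Ideal.ramificationIdx'_eq_ramificationIdx v.maxSpec.asIdeal _ v.maxSpec.ne_bot]
    have h2 := HeightOneSpectrum.valuation_liesOver L v.maxSpec P a
    have h3 : v.maxSpec.valuation K = v.1 := congrArg Subtype.val (ofPrime_maxSpec v)
    rw [h3] at h2
    exact h2.symm
  have hpos : 0 < P.asIdeal.ramificationIdx v.1.valuationSubring :=
    P.asIdeal.ramificationIdx_pos _
  exact ⟨isExtension_of_forall_eq_pow hpos h1, ramExp_eq hpos h1⟩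

variable (L) in
theorem exists_isExtension : ∃ w : DiscVal L, IsExtension (algebraMap K L) v w := by
  obtain ⟨⟨Q, hQ, hQ'⟩⟩ := (inferInstance :
    Nonempty (v.maxSpec.asIdeal.primesOver (ringOfIntegers L v)))
  have hbot : Q ≠ ⊥ := Ideal.ne_bot_of_liesOver_of_ne_bot v.maxSpec.ne_bot Q
  exact ⟨_, (isExtension_ofPrime v ⟨Q, hQ, hbot⟩ (hP := hQ')).1⟩

variable (L) in
theorem finite_extensions : (extensions (algebraMap K L) v).Finite := by
  have hfin : (v.maxSpec.asIdeal.primesOver (ringOfIntegers L v)).Finite :=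
    Algebra.QuasiFinite.finite_primesOver _
  choose P hP hP' using fun w : extensions (algebraMap K L) v =>
    IsExtension.exists_eq_ofPrime w.2
  have := hfin.to_subtype
  refine Set.finite_coe_iff.1 (Finite.of_injective
    (fun w => (⟨(P w).asIdeal, (P w).isPrime, hP' w⟩ :
      v.maxSpec.asIdeal.primesOver (ringOfIntegers L v))) fun w₁ w₂ h => Subtype.ext ?_)
  rw [hP w₁, hP w₂, HeightOneSpectrum.ext (congrArg Subtype.val h)]

end Dedekind

/-! ### Decomposition groups and ramification in Galois extensions. -/

section Galois

variable {K L : Type*} [Field K] [Field L] [Algebra K L] {v : DiscVal K} {w w₁ w₂ : DiscVal L}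

/-- The decomposition group of a discrete valuation. -/
def decompositionGroup (K : Type*) {L : Type*} [Field K] [Field L] [Algebra K L]
    (w : DiscVal L) : Subgroup Gal(L/K) where
  carrier := {σ | ∀ a, w.1 (σ a) = w.1 a}
  one_mem' := fun _ => rfl
  mul_mem' := fun {σ τ} hσ hτ a => (hσ (τ a)).trans (hτ a)
  inv_mem' := fun {σ} hσ a => by
    rw [← hσ (σ⁻¹ a)]
    exact congrArg w.1 (σ.apply_symm_apply a)

theorem mem_decompositionGroup_iff {σ : Gal(L/K)} :
    σ ∈ decompositionGroup K w ↔ ∀ a, w.1 (σ a) = w.1 a := Iff.rfl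

theorem IsExtension.comapEquiv (h : IsExtension (algebraMap K L) v w) (σ : Gal(L/K)) :
    IsExtension (algebraMap K L) v (w.comapEquiv σ.toRingEquiv) := by
  rw [isExtension_iff] at h ⊢
  intro a
  rw [comapEquiv_apply, ← h]
  exact iff_of_eq (congrArg (fun y => w.1 y ≤ 1) (σ.commutes a))

variable [FiniteDimensional K L] [IsGalois K L]

instance (v : DiscVal K) : IsGaloisGroup Gal(L/K) v.1.valuationSubring (ringOfIntegers L v) :=
  IsGaloisGroup.of_isFractionRing Gal(L/K) v.1.valuationSubring (ringOfIntegers L v) K L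

theorem ramExp_eq_of_isGalois (h₁ : IsExtension (algebraMap K L) v w₁)
    (h₂ : IsExtension (algebraMap K L) v w₂) :
    ramExp (algebraMap K L) v w₁ = ramExp (algebraMap K L) v w₂ := by
  obtain ⟨P₁, rfl, hP₁⟩ := h₁.exists_eq_ofPrime
  obtain ⟨P₂, rfl, hP₂⟩ := h₂.exists_eq_ofPrime
  rw [(isExtension_ofPrime v P₁).2, (isExtension_ofPrime v P₂).2]
  exact Ideal.ramificationIdx_eq_of_isGaloisGroup v.maxSpec.asIdeal _ _ Gal(L/K)

theorem ramExp_dvd_card (h : IsExtension (algebraMap K L) v w) :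
    ramExp (algebraMap K L) v w ∣ Nat.card Gal(L/K) := by
  obtain ⟨P, rfl, hP⟩ := h.exists_eq_ofPrime
  rw [(isExtension_ofPrime v P).2,
    ← Ideal.ncard_primesOver_mul_ramificationIdxIn_mul_inertiaDegIn v.maxSpec.asIdeal
      (ringOfIntegers L v) Gal(L/K),
    Ideal.ramificationIdxIn_eq_ramificationIdx v.maxSpec.asIdeal P.asIdeal Gal(L/K)]
  exact Dvd.dvd.mul_left (Dvd.intro _ rfl) _

set_option synthInstance.maxHeartbeats 200000 in
theorem decompositionGroup_eq_stabilizer (P : HeightOneSpectrum (ringOfIntegers L v))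
    [hP : P.asIdeal.LiesOver v.maxSpec.asIdeal] :
    decompositionGroup K (ofPrime P : DiscVal L) = MulAction.stabilizer Gal(L/K) P.asIdeal := by
  have hmem : ∀ b : ringOfIntegers L v, (ofPrime P : DiscVal L).1 (b : L) < 1 ↔ b ∈ P.asIdeal :=
    fun b => P.valuation_lt_one_iff_mem b
  have hcoe : ∀ (σ : Gal(L/K)) (b : ringOfIntegers L v), ((σ • b : ringOfIntegers L v) : L) = σ b :=
    fun _ _ => rfl
  ext σ
  rw [mem_decompositionGroup_iff, MulAction.mem_stabilizer_iff]
  constructor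
  · intro h
    ext b
    rw [Ideal.mem_pointwise_smul_iff_inv_smul_mem, ← hmem, ← hmem, ← h, hcoe]
    exact iff_of_eq (congrArg (fun y => (ofPrime P : DiscVal L).1 y < 1) (σ.apply_symm_apply _))
  · intro h
    have hext := ((isExtension_ofPrime v P).1.comapEquiv σ)
    have heq : (ofPrime P : DiscVal L).comapEquiv σ.toRingEquiv = ofPrime P := by
      refine eq_ofPrime P _ hext.le_one fun b hb => ?_
      have hb' : (ofPrime P : DiscVal L).1 ((σ • b : ringOfIntegers L v) : L) < 1 := hb
      rw [hmem, ← h] at hb'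
      exact (Ideal.smul_mem_pointwise_smul_iff).1 hb'
    intro a
    exact congrArg (fun w : DiscVal L => w.1 a) heq

-- Compare orbit-stabilizer for the transitive action on primes with the identity that the group
-- order is the number of primes times ramification index times inertia degree.
set_option synthInstance.maxHeartbeats 200000 in
theorem card_decompositionGroup (P : HeightOneSpectrum (ringOfIntegers L v))
    [hP : P.asIdeal.LiesOver v.maxSpec.asIdeal] :
    Nat.card (decompositionGroup K (ofPrime P : DiscVal L)) =
      ramExp (algebraMap K L) v (ofPrime P) * P.asIdeal.inertiaDeg v.1.valuationSubring := by
  rw [(isExtension_ofPrime v P).2, decompositionGroup_eq_stabilizer]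
  have h1 := Ideal.ncard_primesOver_mul_ramificationIdxIn_mul_inertiaDegIn v.maxSpec.asIdeal
      (ringOfIntegers L v) Gal(L/K)
  rw [Ideal.ramificationIdxIn_eq_ramificationIdx v.maxSpec.asIdeal P.asIdeal Gal(L/K),
    Ideal.inertiaDegIn_eq_inertiaDeg v.maxSpec.asIdeal P.asIdeal Gal(L/K),
    ← Algebra.IsInvariant.orbit_eq_primesOver v.1.valuationSubring (ringOfIntegers L v) Gal(L/K)
      v.maxSpec.asIdeal P.asIdeal, ← MulAction.index_stabilizer, mul_comm] at h1
  have h2 := (MulAction.stabilizer Gal(L/K) P.asIdeal).card_mul_index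
  rw [← h1] at h2
  exact Nat.eq_of_mul_eq_mul_right (Nat.pos_of_ne_zero
    (MulAction.stabilizer Gal(L/K) P.asIdeal).index_ne_zero_of_finite) h2

/-- The condition `hres` says that the residue extension is trivial. Stated through elements, it
passes to intermediate fields without comparing residue fields. -/
theorem card_decompositionGroup_of_residue (h : IsExtension (algebraMap K L) v w)
    (hres : ∀ x, w.1 x ≤ 1 → ∃ a : K, w.1 (x - algebraMap K L a) < 1) :
    Nat.card (decompositionGroup K w) = ramExp (algebraMap K L) v w := by
  obtain ⟨P, rfl, hP⟩ := h.exists_eq_ofPrime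
  rw [card_decompositionGroup]
  have : P.asIdeal.inertiaDeg v.1.valuationSubring = 1 := by
    have hmax : v.maxSpec.asIdeal.IsMaximal := v.maxSpec.isMaximal
    have hmax' : P.asIdeal.IsMaximal := P.isMaximal
    rw [← Ideal.inertiaDeg'_eq_inertiaDeg v.maxSpec.asIdeal, Ideal.inertiaDeg'_algebraMap]
    let : Field (v.1.valuationSubring ⧸ v.maxSpec.asIdeal) := Ideal.Quotient.field _
    refine (finrank_eq_one_iff_of_nonzero' (1 : ringOfIntegers L v ⧸ P.asIdeal) one_ne_zero).2
      fun y => ?_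
    obtain ⟨b, rfl⟩ := Ideal.Quotient.mk_surjective y
    obtain ⟨a, ha⟩ := hres b (h.le_one b)
    have haA : v.1 a ≤ 1 := by
      rw [← isExtension_iff.1 h]
      have := (ofPrime P : DiscVal L).1.map_sub_le (h.le_one b) ha.le
      rwa [sub_sub_cancel] at this
    refine ⟨Ideal.Quotient.mk _ ⟨a, haA⟩, ?_⟩
    rw [Algebra.smul_def, mul_one]
    refine (Ideal.Quotient.eq.2 ?_).symm
    rw [← P.valuation_lt_one_iff_mem (K := L)]
    exact ha
  rw [this, mul_one]

omit [IsGalois K L] in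
theorem exists_residue_of_isAlgClosed [Algebra.IsSeparable K L]
    (h : IsExtension (algebraMap K L) v w)
    (halg : IsAlgClosed v.Residue) (x : L) (hx : w.1 x ≤ 1) :
    ∃ a : K, w.1 (x - algebraMap K L a) < 1 := by
  obtain ⟨P, rfl, hP⟩ := h.exists_eq_ofPrime
  obtain ⟨b, hb⟩ := P.exists_valuation_sub_lt_of_integer hx 1
  have hmax : v.maxSpec.asIdeal.IsMaximal := v.maxSpec.isMaximal
  let : Field (v.1.valuationSubring ⧸ v.maxSpec.asIdeal) := Ideal.Quotient.field _
  have halg' : IsAlgClosed (v.1.valuationSubring ⧸ v.maxSpec.asIdeal) := halg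
  have hbij := IsAlgClosed.algebraMap_bijective_of_isIntegral
    (k := v.1.valuationSubring ⧸ v.maxSpec.asIdeal) (K := ringOfIntegers L v ⧸ P.asIdeal)
  obtain ⟨c, hc⟩ := hbij.2 (Ideal.Quotient.mk _ b)
  obtain ⟨a, rfl⟩ := Ideal.Quotient.mk_surjective c
  have hc' : b - algebraMap _ _ a ∈ P.asIdeal := Ideal.Quotient.eq.1 hc.symm
  rw [← P.valuation_lt_one_iff_mem (K := L)] at hc'
  refine ⟨a, ?_⟩
  have := (ofPrime P : DiscVal L).1.map_sub_lt hc' hb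
  refine lt_of_eq_of_lt (congrArg _ ?_) this
  exact (sub_sub_sub_cancel_left ..).symm

end Galois

/-! ### Wild group, tame character and Abhyankar's lemma. -/

section Wild

variable {K L : Type*} [Field K] [Field L] [Algebra K L] {v : DiscVal K} {w : DiscVal L}

theorem map_eq_of_sub_lt {x y : L} (h : w.1 (x - y) < w.1 y) : w.1 x = w.1 y := by
  have := w.1.map_add_eq_of_lt_left h
  rwa [add_sub_cancel] at this

/-- The automorphisms moving every element by an element of larger value. -/
def wildGroup (K : Type*) {L : Type*} [Field K] [Field L] [Algebra K L]
    (w : DiscVal L) : Subgroup Gal(L/K) where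
  carrier := {σ | ∀ y, y ≠ 0 → w.1 (σ y - y) < w.1 y}
  one_mem' := fun y hy => by simpa [zero_lt_iff] using hy
  mul_mem' := fun {σ τ} hσ hτ y hy => by
    have h1 := hσ (τ y) (by simpa using hy)
    rw [map_eq_of_sub_lt (hτ y hy)] at h1
    have := w.1.map_add_lt h1 (hτ y hy)
    rwa [sub_add_sub_cancel] at this
  inv_mem' := fun {σ} hσ y hy => by
    have h1 := hσ (σ⁻¹ y) (by simpa using hy)
    have h2 : σ (σ⁻¹ y) = y := σ.apply_symm_apply y
    rw [h2] at h1
    rwa [w.1.map_sub_swap, map_eq_of_sub_lt h1]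

theorem wildGroup_le_decompositionGroup : wildGroup K w ≤ decompositionGroup K w := by
  intro σ hσ a
  by_cases ha : a = 0
  · simp [ha]
  · exact map_eq_of_sub_lt (hσ a ha)

theorem conj_mem_wildGroup {σ : Gal(L/K)} (hσ : σ ∈ wildGroup K w) (τ : Gal(L/K)) :
    τ * σ * τ⁻¹ ∈ wildGroup K (w.comapEquiv τ⁻¹.toRingEquiv) := by
  intro y hy
  have h := hσ (τ⁻¹ y) (by simpa using hy)
  have h2 : ∀ z, τ⁻¹ (τ z) = z := fun z => τ.symm_apply_apply z
  change w.1 (τ⁻¹ (τ (σ (τ⁻¹ y)) - y)) < w.1 (τ⁻¹ y)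
  rwa [map_sub, h2]

theorem conj_mem_decompositionGroup {σ : Gal(L/K)} (hσ : σ ∈ decompositionGroup K w)
    (τ : Gal(L/K)) :
    τ * σ * τ⁻¹ ∈ decompositionGroup K (w.comapEquiv τ⁻¹.toRingEquiv) := by
  intro y
  have h := hσ (τ⁻¹ y)
  have h2 : ∀ z, τ⁻¹ (τ z) = z := fun z => τ.symm_apply_apply z
  change w.1 (τ⁻¹ (τ (σ (τ⁻¹ y)))) = w.1 (τ⁻¹ y)
  rwa [h2]

theorem comapEquiv_inv_of_mem {τ : Gal(L/K)} (hτ : τ ∈ decompositionGroup K w) :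
    w.comapEquiv τ⁻¹.toRingEquiv = w :=
  Subtype.ext (Valuation.ext fun a => (decompositionGroup K w).inv_mem hτ a)

/-- For y = σx − x the sum of its first q conjugates under powers of σ telescopes to 0, while each
conjugate agrees with y to leading order; so qy has smaller valuation than y. -/
theorem natCast_lt_one_of_mem_wildGroup {σ : Gal(L/K)} (hσ : σ ∈ wildGroup K w) (hσ1 : σ ≠ 1)
    {q : ℕ} (hq : σ ^ q = 1) : w.1 (q : L) < 1 := by
  obtain ⟨x, hx⟩ : ∃ x, σ x ≠ x := by
    by_contra! hcon
    exact hσ1 (AlgEquiv.ext hcon)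
  set y := σ x - x with hy
  have hy0 : y ≠ 0 := sub_ne_zero.2 hx
  have hsum : ∑ i ∈ Finset.range q, (σ ^ i) y = 0 := by
    have : ∀ i, (σ ^ i) y = (σ ^ (i + 1)) x - (σ ^ i) x := by
      intro i
      rw [hy, map_sub, pow_succ, AlgEquiv.mul_apply]
    simp_rw [this]
    rw [Finset.sum_range_sub (fun i => (σ ^ i) x), hq]
    simp
  have hlt : w.1 (∑ i ∈ Finset.range q, ((σ ^ i) y - y)) < w.1 y :=
    w.1.map_sum_lt (by simpa using hy0) fun i _ => (wildGroup K w).pow_mem hσ i y hy0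
  rw [Finset.sum_sub_distrib, hsum, zero_sub, Valuation.map_neg, Finset.sum_const,
    Finset.card_range, nsmul_eq_mul, map_mul] at hlt
  by_contra hge
  push Not at hge
  exact absurd hlt (not_lt.2 (le_mul_of_one_le_left' hge))

theorem residue_smul {σ : Gal(L/K)} (hσ : σ ∈ decompositionGroup K w)
    (hres : ∀ x, w.1 x ≤ 1 → ∃ a : K, w.1 (x - algebraMap K L a) < 1) {x : L}
    (hx : w.1 x ≤ 1) : w.1 (σ x - x) < 1 := by
  obtain ⟨a, ha⟩ := hres x hx
  have h1 : w.1 (σ x - algebraMap K L a) < 1 := by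
    rw [← σ.commutes a, ← map_sub, hσ]
    exact ha
  have := w.1.map_sub_lt h1 ha
  rwa [sub_sub_sub_cancel_right] at this

theorem sub_lt_mul {σ : Gal(L/K)} {y z : L} (hy : w.1 (σ y - y) < w.1 y)
    (hz : w.1 (σ z - z) < w.1 z) : w.1 (σ (y * z) - y * z) < w.1 (y * z) := by
  have h1 : σ (y * z) - y * z = σ y * (σ z - z) + (σ y - y) * z := by
    rw [map_mul]; ring
  have hy0 : 0 < w.1 y := zero_le.trans_lt hy
  have hz0 : 0 < w.1 z := zero_le.trans_lt hz
  rw [h1, map_mul w.1 y z]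
  refine w.1.map_add_lt ?_ ?_
  · rw [map_mul, map_eq_of_sub_lt hy]
    exact mul_lt_mul_of_pos_left hz hy0
  · rw [map_mul]
    exact mul_lt_mul_of_pos_right hy hz0

theorem sub_lt_inv {σ : Gal(L/K)} {y : L} (hy : w.1 (σ y - y) < w.1 y) :
    w.1 (σ y⁻¹ - y⁻¹) < w.1 y⁻¹ := by
  have hy0 : 0 < w.1 y := zero_le.trans_lt hy
  have hy1 : y ≠ 0 := by simpa [zero_lt_iff] using hy0
  have hy2 : σ y ≠ 0 := by simpa using hy1
  have h1 : σ y⁻¹ - y⁻¹ = (y - σ y) * ((σ y)⁻¹ * y⁻¹) := by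
    rw [map_inv₀]; field_simp
  rw [h1, map_mul, w.1.map_sub_swap, map_mul, map_inv₀ w.1, map_inv₀ w.1, map_eq_of_sub_lt hy]
  calc w.1 (σ y - y) * ((w.1 y)⁻¹ * (w.1 y)⁻¹) < w.1 y * ((w.1 y)⁻¹ * (w.1 y)⁻¹) :=
        mul_lt_mul_of_pos_right hy (by simp [hy0])
    _ = (w.1 y)⁻¹ := by rw [← mul_assoc, mul_inv_cancel₀ hy0.ne', one_mul]

/-- The wild condition is multiplicative, and every nonzero element is a unit times a power of `π`;
units satisfy it because the residue extension is trivial. -/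
theorem mem_wildGroup_of_uniformizer {σ : Gal(L/K)} (hσ : σ ∈ decompositionGroup K w)
    (hres : ∀ x, w.1 x ≤ 1 → ∃ a : K, w.1 (x - algebraMap K L a) < 1)
    {π : L} (hπ : w.1 π = WithZero.exp (-1 : ℤ)) (hlt : w.1 (σ π - π) < w.1 π) :
    σ ∈ wildGroup K w := by
  have hpow : ∀ n : ℕ, w.1 (σ (π ^ n) - π ^ n) < w.1 (π ^ n) := by
    intro n
    induction n with
    | zero => simp
    | succ n ih => rw [pow_succ]; exact sub_lt_mul ih hlt
  have hzpow : ∀ n : ℤ, w.1 (σ (π ^ n) - π ^ n) < w.1 (π ^ n) := by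
    intro n
    obtain ⟨n, rfl | rfl⟩ := n.eq_nat_or_neg
    · simpa using hpow n
    · rw [zpow_neg, zpow_natCast]
      exact sub_lt_inv (hpow n)
  have hπ0 : π ≠ 0 := by
    rintro rfl
    simp at hlt
  intro y hy
  have hwy : w.1 y ≠ 0 := by simpa using hy
  set n := WithZero.log (w.1 y)
  have hu : w.1 (π ^ n * y) = 1 := by
    rw [map_mul, map_zpow₀, hπ, ← WithZero.exp_log hwy, ← WithZero.exp_zsmul, ← WithZero.exp_add]
    simp [n]
  have hu' : w.1 (σ (π ^ n * y) - π ^ n * y) < w.1 (π ^ n * y) := by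
    rw [hu]
    exact residue_smul hσ hres hu.le
  have := sub_lt_mul (hzpow (-n)) hu'
  rwa [← mul_assoc, ← zpow_add₀ hπ0, neg_add_cancel, zpow_zero, one_mul] at this

/-- The tame character of the decomposition group, with values in the residue field. -/
noncomputable def tameCharacter
    (hres : ∀ x, w.1 x ≤ 1 → ∃ a : K, w.1 (x - algebraMap K L a) < 1) {π : L} (hπ : π ≠ 0) :
    decompositionGroup K w →* w.Residue where
  toFun σ := IsLocalRing.residue _ (⟨σ.1 π / π, by
    rw [Valuation.mem_valuationSubring_iff, map_div₀, σ.2, div_self (by simpa using hπ)]⟩ :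
      w.1.valuationSubring)
  map_one' := by
    rw [← map_one (IsLocalRing.residue w.1.valuationSubring)]
    congr 1
    exact Subtype.ext (div_self hπ)
  map_mul' := fun σ τ => by
    rw [← map_mul]
    refine Ideal.Quotient.eq.2 ?_
    rw [mem_maximalIdeal_iff]
    change w.1 (σ.1 (τ.1 π) / π - σ.1 π / π * (τ.1 π / π)) < 1
    have hσπ : σ.1 π ≠ 0 := by simpa using hπ
    have h1 : σ.1 (τ.1 π) / π - σ.1 π / π * (τ.1 π / π) =
        σ.1 π / π * (σ.1 (τ.1 π / π) - τ.1 π / π) := by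
      rw [map_div₀]; field_simp
    have hw : w.1 π ≠ 0 := by simpa using hπ
    rw [h1, map_mul, map_div₀, σ.2, div_self hw, one_mul]
    refine residue_smul σ.2 hres ?_
    rw [map_div₀, τ.2, div_self hw]

/-- The kernel of the tame character lies in the wild group, and a finite group embedding in the
multiplicative monoid of a field is cyclic. -/
theorem isCyclic_decompositionGroup [Finite Gal(L/K)]
    (hres : ∀ x, w.1 x ≤ 1 → ∃ a : K, w.1 (x - algebraMap K L a) < 1)
    (hwild : wildGroup K w = ⊥) : IsCyclic (decompositionGroup K w) := by
  obtain ⟨π, hπ, hπ0⟩ := exists_uniformizer w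
  refine isCyclic_of_injective_ringHom (tameCharacter hres hπ0) ?_
  rw [injective_iff_map_eq_one]
  intro σ hσ
  have hw : w.1 π ≠ 0 := by simpa using hπ0
  have h1 : w.1 (σ.1 π / π - 1) < 1 := by
    rw [← map_one (IsLocalRing.residue w.1.valuationSubring)] at hσ
    have := Ideal.Quotient.eq.1 hσ
    rwa [mem_maximalIdeal_iff] at this
  have h2 : σ.1 ∈ wildGroup K w := by
    refine mem_wildGroup_of_uniformizer σ.2 hres hπ ?_
    rwa [div_sub_one hπ0, map_div₀, div_lt_one₀ (zero_lt_iff.2 hw)] at h1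
  rw [hwild, Subgroup.mem_bot] at h2
  exact Subtype.ext h2

theorem _root_.Subgroup.le_of_coprime_card_index {G : Type*} [Group G] [Finite G]
    (H P : Subgroup G) [P.Normal] (h : (Nat.card P).Coprime H.index) : P ≤ H := by
  rw [← Subgroup.relIndex_eq_one]
  refine Nat.eq_one_of_dvd_coprimes h (H.relIndex_dvd_card P) ?_
  -- Here `k` is the index of the product HP.
  obtain ⟨k, hk⟩ := P.relIndex_dvd_index_of_normal H
  refine ⟨k, ?_⟩
  have h1 := H.card_mul_index
  have h2 := P.card_mul_index
  have h3 : Nat.card (H ⊓ P : Subgroup G) * P.relIndex H = Nat.card H := by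
    rw [← Subgroup.inf_relIndex_left, ← Subgroup.relIndex_bot_left, ← Subgroup.relIndex_bot_left,
      Subgroup.relIndex_mul_relIndex _ _ _ bot_le inf_le_left]
  have h4 : Nat.card (H ⊓ P : Subgroup G) * H.relIndex P = Nat.card P := by
    rw [← Subgroup.inf_relIndex_right, ← Subgroup.relIndex_bot_left, ← Subgroup.relIndex_bot_left,
      Subgroup.relIndex_mul_relIndex _ _ _ bot_le inf_le_right]
  rw [hk, ← h4] at h2
  rw [← h3] at h1
  have h5 : Nat.card (H ⊓ P : Subgroup G) * P.relIndex H ≠ 0 := by rw [h3]; exact Nat.card_pos.ne'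
  refine Nat.eq_of_mul_eq_mul_left (Nat.pos_of_ne_zero h5) ?_
  rw [h1, ← h2]
  ring

/-- The wild group is normal in the decomposition group, and by Cauchy only primes of value below 1
divide its order; tameness makes that order coprime to the relative index of `H`. -/
theorem wildGroup_le_of_tame [Finite Gal(L/K)] (H : Subgroup Gal(L/K))
    (htame : ∀ q : ℕ, q.Prime → w.1 (q : L) < 1 → ¬ q ∣ H.relIndex (decompositionGroup K w)) :
    wildGroup K w ≤ H := by
  have hn : ((wildGroup K w).subgroupOf (decompositionGroup K w)).Normal := by
    refine ⟨fun σ hσ τ => ?_⟩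
    rw [Subgroup.mem_subgroupOf] at hσ ⊢
    have := conj_mem_wildGroup hσ τ.1
    rwa [comapEquiv_inv_of_mem τ.2] at this
  have hle := Subgroup.le_of_coprime_card_index (H.subgroupOf (decompositionGroup K w))
    ((wildGroup K w).subgroupOf (decompositionGroup K w)) (by
      refine Nat.Coprime.symm (Nat.coprime_of_dvd fun q hq h1 h2 => ?_)
      have := Fact.mk hq
      obtain ⟨σ, hσ⟩ := exists_prime_orderOf_dvd_card' q h2
      refine htame q hq (natCast_lt_one_of_mem_wildGroup (σ := σ.1.1) σ.2 ?_ ?_) h1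
      · intro h
        have : σ = 1 := Subtype.ext (Subtype.ext h)
        rw [this, orderOf_one] at hσ
        exact hq.one_lt.ne hσ
      · have := pow_orderOf_eq_one σ
        rw [hσ] at this
        exact congrArg (fun x => x.1.1) this)
  intro σ hσ
  exact hle (x := ⟨σ, wildGroup_le_decompositionGroup hσ⟩) hσ

/-- Abhyankar's lemma for a Galois closure: if all extensions of `v` are tamely ramified relative
to a core-free subgroup `H`, the decomposition groups have order dividing a common multiple of
the relative indices. -/
theorem card_decompositionGroup_dvd [Finite Gal(L/K)] (H : Subgroup Gal(L/K))
    (hcore : ∀ σ, (∀ τ, τ * σ * τ⁻¹ ∈ H) → σ = 1) (hw : IsExtension (algebraMap K L) v w)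
    (hres : ∀ w : DiscVal L, IsExtension (algebraMap K L) v w →
      ∀ x, w.1 x ≤ 1 → ∃ a : K, w.1 (x - algebraMap K L a) < 1) (N : ℕ)
    (hN : ∀ w : DiscVal L, IsExtension (algebraMap K L) v w →
      H.relIndex (decompositionGroup K w) ∣ N)
    (htame : ∀ w : DiscVal L, IsExtension (algebraMap K L) v w → ∀ q : ℕ, q.Prime →
      w.1 (q : L) < 1 → ¬ q ∣ H.relIndex (decompositionGroup K w)) :
    Nat.card (decompositionGroup K w) ∣ N := by
  -- Conjugating a wild element gives a wild element at a conjugate valuation, again in `H`; so it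
  -- lies in the trivial core.
  have hwild : ∀ w : DiscVal L, IsExtension (algebraMap K L) v w → wildGroup K w = ⊥ := by
    intro w hw
    rw [eq_bot_iff]
    intro σ hσ
    exact Subgroup.mem_bot.2 (hcore σ fun τ =>
      wildGroup_le_of_tame H (htame _ (hw.comapEquiv τ⁻¹)) (conj_mem_wildGroup hσ τ))
  have hcyc : ∀ w : DiscVal L, IsExtension (algebraMap K L) v w →
      IsCyclic (decompositionGroup K w) :=
    fun w hw => isCyclic_decompositionGroup (hres w hw) (hwild w hw)
  have := hcyc w hw
  rw [← IsCyclic.exponent_eq_card]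
  refine Monoid.exponent_dvd_of_forall_pow_eq_one fun σ => Subtype.ext ?_
  refine hcore _ fun τ => ?_
  have hw' := hw.comapEquiv τ⁻¹
  have hcyc' := hcyc _ hw'
  let g : decompositionGroup K (w.comapEquiv τ⁻¹.toRingEquiv) :=
    ⟨τ * σ.1 * τ⁻¹, conj_mem_decompositionGroup σ.2 τ⟩
  -- This decomposition group is abelian, so the index of its intersection with `H` kills the
  -- quotient.
  have hg : g ^ N ∈ H.subgroupOf (decompositionGroup K (w.comapEquiv τ⁻¹.toRingEquiv)) := by
    let := hcyc'.commGroup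
    obtain ⟨k, hk⟩ := hN _ hw'
    rw [hk, pow_mul]
    exact Subgroup.pow_mem _ (Subgroup.pow_index_mem _ g) k
  have hg' : (g ^ N : decompositionGroup K _).1 ∈ H := hg
  rw [Subgroup.coe_pow] at hg'
  change τ * (σ ^ N : decompositionGroup K w).1 * τ⁻¹ ∈ H
  rw [Subgroup.coe_pow, ← conj_pow]
  exact hg'

end Wild

end DiscVal

/-! ### Root transformations preserve splitting. -/

theorem Polynomial.reverse_reverse_of_coeff_zero {R : Type*} [Semiring R] {f : R[X]}
    (h : f.coeff 0 ≠ 0) : f.reverse.reverse = f := by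
  have h1 : f.reverse.natDegree = f.natDegree := by
    rw [reverse_natDegree, natTrailingDegree_eq_zero.2 (Or.inr h), Nat.sub_zero]
  rw [reverse, h1, reverse, reflect_reflect]

theorem Polynomial.Splits.reverse {F : Type*} [Field F] {f : F[X]} (hf : f.Splits) :
    f.reverse.Splits := by
  induction hf using Submonoid.closure_induction with
  | mem x hx =>
    refine Splits.of_natDegree_le_one ((reverse_natDegree_le x).trans ?_)
    rcases hx with ⟨a, rfl⟩ | ⟨a, rfl⟩ <;> simp
  | one => exact Splits.of_natDegree_le_one ((reverse_natDegree_le 1).trans (by simp))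
  | mul x y _ _ hx hy => rw [reverse_mul_of_domain]; exact hx.mul hy

theorem Polynomial.splits_reverse_iff {F : Type*} [Field F] {f : F[X]} (h : f.coeff 0 ≠ 0) :
    f.reverse.Splits ↔ f.Splits :=
  ⟨fun hf => reverse_reverse_of_coeff_zero h ▸ hf.reverse, fun hf => hf.reverse⟩

theorem Polynomial.splits_scaleRoots_iff {F : Type*} [Field F] {f : F[X]} {c : F} (hc : c ≠ 0) :
    (f.scaleRoots c).Splits ↔ f.Splits := by
  refine ⟨fun h => ?_, fun h => h.scaleRoots c⟩
  have := h.scaleRoots c⁻¹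
  rwa [← scaleRoots_mul, mul_inv_cancel₀ hc, scaleRoots_one] at this

theorem RootTransform.splits_map_iff {F E : Type*} [Field F] [Field E] (φ : F →+* E) {f g : F[X]}
    (h : RootTransform f g) : (g.map φ).Splits ↔ (f.map φ).Splits := by
  cases h with
  | scale c hc =>
    by_cases hf : f = 0
    · simp [hf]
    · rw [map_scaleRoots _ _ _ (by simpa using hf)]
      exact splits_scaleRoots_iff (by simpa using hc)
  | reciprocate h0 =>
    have h1 : f.reverse.map φ = (f.map φ).reverse := by
      simp [Polynomial.reverse, reflect_map]
    rw [Polynomial.map_mul, map_C, h1, ← splits_reverse_iff (f := f.map φ) (by simpa using h0)]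
    refine splits_mul_iff_right ?_ (Splits.C _)
    simpa using h0
  | decrease c =>
    rw [Polynomial.map_comp, Polynomial.map_add, map_X, map_C]
    refine (splits_iff_comp_splits_of_natDegree_eq_one (natDegree_X_add_C _)).symm

theorem RootTransform.splits_map_iff_of_transGen {F E : Type*} [Field F] [Field E] (φ : F →+* E)
    {f g : F[X]} (h : Relation.TransGen RootTransform f g) :
    (g.map φ).Splits ↔ (f.map φ).Splits := by
  induction h with
  | single h => exact h.splits_map_iff φ
  | tail _ h ih => exact (h.splits_map_iff φ).trans ih

/-! ### Discarding a root, and irreducibility in prime degree. -/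

section Subfields

variable {L : Type*} [Field L]

theorem splits_of_throw_root {K K' M : Subfield L} (hM : K ≤ M) {g : K[X]} {f : K'[X]} {α : L}
    (hg : g.Monic) (hK' : K' = K⟮α⟯.toSubfield)
    (hfg : g.map K.subtype = (X - C α) * f.map K'.subtype)
    (hs : (g.map (Subfield.inclusion hM)).Splits) :
    ∃ h : K' ≤ M, (f.map (Subfield.inclusion h)).Splits := by
  have hgM : (g.map (Subfield.inclusion hM)).map M.subtype = g.map K.subtype := by
    rw [Polynomial.map_map]; rfl
  have hα : α ∈ M := by
    have hroot : ((g.map (Subfield.inclusion hM)).map M.subtype).IsRoot α := by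
      rw [hgM, hfg]
      simp
    obtain ⟨a, rfl⟩ := hs.mem_range_of_isRoot (hg.map _).ne_zero hroot
    exact a.2
  have hle : K' ≤ M := by
    rw [hK', IntermediateField.adjoin_toSubfield, Subfield.closure_le]
    rintro x (⟨a, rfl⟩ | rfl)
    · exact hM a.2
    · exact hα
  refine ⟨hle, hs.of_dvd (hg.map _).ne_zero ?_⟩
  rw [← Polynomial.map_dvd_map' M.subtype, hgM, hfg, Polynomial.map_map]
  exact Dvd.intro_left _ rfl

/-- An automorphism of order `p` moves some root, whose orbit then has exactly `p` elements. All are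
roots of its minimal polynomial, which therefore has the full degree of `g`. -/
theorem irreducible_of_prime_dvd_card_gal {F : Type*} [Field F] [Algebra F L] {p : ℕ}
    (hp : p.Prime) {g : F[X]} (hg : g.Monic) (hdeg : g.natDegree = p)
    [hL : g.IsSplittingField F L] (hdvd : p ∣ Nat.card Gal(L/F)) : Irreducible g := by
  have := Fact.mk hp
  have hfin : FiniteDimensional F L := IsSplittingField.finiteDimensional L g
  obtain ⟨σ, hσ⟩ := exists_prime_orderOf_dvd_card' p hdvd
  obtain ⟨x, hx, hσx⟩ : ∃ x ∈ g.rootSet L, σ x ≠ x := by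
    by_contra! hcon
    have h1 : (σ : L →ₐ[F] L) = AlgHom.id F L :=
      AlgHom.ext_of_adjoin_eq_top (IsSplittingField.adjoin_rootSet L g) hcon
    have : σ = 1 := AlgEquiv.ext fun x => DFunLike.congr_fun h1 x
    rw [this, orderOf_one] at hσ
    exact hp.one_lt.ne hσ
  have hx0 : aeval x g = 0 := (mem_rootSet.1 hx).2
  have hint : IsIntegral F x := ⟨g, hg, hx0⟩
  have hper : Function.minimalPeriod σ x = p := by
    refine ((Nat.dvd_prime hp).1 (Function.IsPeriodicPt.minimalPeriod_dvd ?_)).resolve_left ?_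
    · have h2 := pow_orderOf_eq_one σ
      rw [hσ] at h2
      have h3 : (σ ^ p) x = x := by rw [h2]; rfl
      rwa [AlgEquiv.coe_pow] at h3
    · intro h
      exact hσx (Function.minimalPeriod_eq_one_iff_isFixedPt.1 h)
  have hcard : p ≤ (minpoly F x).natDegree := by
    classical
    let S : Finset L := (Finset.range p).image fun i => σ^[i] x
    have hS : S.card = p := by
      rw [Finset.card_image_of_injOn, Finset.card_range]
      intro i hi j hj hij
      rw [Finset.coe_range, Set.mem_Iio, ← hper] at hi hj
      exact Function.iterate_injOn_Iio_minimalPeriod hi hj hij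
    rw [← hS, ← Polynomial.natDegree_map (algebraMap F L)]
    refine Polynomial.card_le_degree_of_subset_roots fun y hy => ?_
    rw [Finset.mem_val, Finset.mem_image] at hy
    obtain ⟨i, -, rfl⟩ := hy
    rw [mem_roots ((minpoly.monic hint).map _).ne_zero, IsRoot.def, eval_map_algebraMap,
      ← AlgEquiv.coe_pow]
    change aeval ((σ ^ i : Gal(L/F)).toAlgHom x) (minpoly F x) = 0
    rw [aeval_algHom_apply, minpoly.aeval, map_zero]
  have : minpoly F x = g :=
    (eq_of_monic_of_dvd_of_natDegree_le (minpoly.monic hint) hg (minpoly.dvd F x hx0)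
      (hdeg ▸ hcard)).symm
  rw [← this]
  exact minpoly.irreducible hint

end Subfields

universe u

namespace DiscVal

/-! ### Exponents in a tower whose top is Galois over the bottom. -/

section Tower

variable {K E L : Type*} [Field K] [Field E] [Field L] [Algebra K E] [Algebra E L] [Algebra K L]
  [IsScalarTower K E L] {v : DiscVal K} {u : DiscVal E} {w : DiscVal L}

theorem IsExtension.tower (h₁ : IsExtension (algebraMap K E) v u)
    (h₂ : IsExtension (algebraMap E L) u w) : IsExtension (algebraMap K L) v w := by
  rw [IsScalarTower.algebraMap_eq K E L]
  exact h₁.trans h₂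

theorem ramExp_tower (h₁ : IsExtension (algebraMap K E) v u)
    (h₂ : IsExtension (algebraMap E L) u w) :
    ramExp (algebraMap K L) v w = ramExp (algebraMap K E) v u * ramExp (algebraMap E L) u w := by
  rw [IsScalarTower.algebraMap_eq K E L]
  exact ramExp_comp h₁ h₂

theorem exists_restrict_tower (h : IsExtension (algebraMap K L) v w) :
    ∃ u : DiscVal E, IsExtension (algebraMap K E) v u ∧ IsExtension (algebraMap E L) u w := by
  rw [IsScalarTower.algebraMap_eq K E L] at h
  exact exists_restrict h

variable [FiniteDimensional K L] [IsGalois K L]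

/-- Although `w` need not lie over `u`, its exponent equals that of an extension which does. -/
theorem ramExp_dvd_of_isGalois (hu : IsExtension (algebraMap K E) v u)
    (hw : IsExtension (algebraMap K L) v w) :
    ramExp (algebraMap K E) v u ∣ ramExp (algebraMap K L) v w := by
  have : FiniteDimensional E L := FiniteDimensional.right K E L
  have : IsGalois E L := IsGalois.tower_top_of_isGalois K E L
  obtain ⟨w', hw'⟩ := exists_isExtension L u
  rw [ramExp_eq_of_isGalois hw (hu.tower hw'), ramExp_tower hu hw']
  exact Dvd.intro _ rfl

omit [FiniteDimensional K L] [IsGalois K L] in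
theorem card_inf_decompositionGroup :
    Nat.card ((AlgEquiv.restrictScalarsHom K : Gal(L/E) →* Gal(L/K)).range ⊓
      decompositionGroup K w : Subgroup Gal(L/K)) = Nat.card (decompositionGroup E w) := by
  have h : (AlgEquiv.restrictScalarsHom K : Gal(L/E) →* Gal(L/K)).range ⊓
      decompositionGroup K w = (decompositionGroup E w).map (AlgEquiv.restrictScalarsHom K) := by
    ext σ
    rw [Subgroup.mem_inf, Subgroup.mem_map]
    constructor
    · rintro ⟨⟨τ, rfl⟩, hτ⟩
      exact ⟨τ, hτ, rfl⟩
    · rintro ⟨τ, hτ, rfl⟩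
      exact ⟨⟨τ, rfl⟩, hτ⟩
  rw [h]
  exact (Nat.card_congr (Subgroup.equivMapOfInjective _ _
    (AlgEquiv.restrictScalarsHom_injective K)).toEquiv).symm

/-- Both decomposition groups have order equal to their exponent over `L`, and the one over `E` is
the intersection of the other with `Gal(L/E)`; multiplicativity gives the quotient. -/
theorem relIndex_decompositionGroup (hu : IsExtension (algebraMap K E) v u)
    (hw : IsExtension (algebraMap E L) u w)
    (hres : ∀ x, w.1 x ≤ 1 → ∃ a : K, w.1 (x - algebraMap K L a) < 1) :
    (AlgEquiv.restrictScalarsHom K : Gal(L/E) →* Gal(L/K)).range.relIndex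
      (decompositionGroup K w) = ramExp (algebraMap K E) v u := by
  have : FiniteDimensional E L := FiniteDimensional.right K E L
  have : IsGalois E L := IsGalois.tower_top_of_isGalois K E L
  have h1 := card_decompositionGroup_of_residue (hu.tower hw) hres
  have h2 := card_decompositionGroup_of_residue hw fun x hx => by
    obtain ⟨a, ha⟩ := hres x hx
    exact ⟨algebraMap K E a, by rwa [← IsScalarTower.algebraMap_apply]⟩
  have h3 := Subgroup.relIndex_mul_relIndex ⊥ _ _ bot_le
    (inf_le_right (a := (AlgEquiv.restrictScalarsHom K : Gal(L/E) →* Gal(L/K)).range)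
      (b := decompositionGroup K w))
  rw [Subgroup.relIndex_bot_left, Subgroup.relIndex_bot_left, card_inf_decompositionGroup, h1, h2,
    Subgroup.inf_relIndex_right, ramExp_tower hu hw, mul_comm] at h3
  exact Nat.eq_of_mul_eq_mul_right (ramExp_pos hw) h3

/-- Abhyankar's lemma in terms of ramification exponents. -/
theorem ramExp_dvd_of_tame
    (hcore : ∀ σ : Gal(L/K),
      (∀ τ, τ * σ * τ⁻¹ ∈ (AlgEquiv.restrictScalarsHom K : Gal(L/E) →* Gal(L/K)).range) → σ = 1)
    (hw : IsExtension (algebraMap K L) v w)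
    (hres : ∀ w : DiscVal L, IsExtension (algebraMap K L) v w →
      ∀ x, w.1 x ≤ 1 → ∃ a : K, w.1 (x - algebraMap K L a) < 1) (N : ℕ)
    (hN : ∀ u ∈ extensions (algebraMap K E) v, ramExp (algebraMap K E) v u ∣ N)
    (htame : ∀ u ∈ extensions (algebraMap K E) v, ∀ q : ℕ, q.Prime →
      v.1 (q : K) < 1 → ¬ q ∣ ramExp (algebraMap K E) v u) :
    ramExp (algebraMap K L) v w ∣ N := by
  rw [← card_decompositionGroup_of_residue hw (hres w hw)]
  have key : ∀ w : DiscVal L, IsExtension (algebraMap K L) v w →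
      ∃ u ∈ extensions (algebraMap K E) v,
        (AlgEquiv.restrictScalarsHom K : Gal(L/E) →* Gal(L/K)).range.relIndex
          (decompositionGroup K w) = ramExp (algebraMap K E) v u := by
    intro w hw
    obtain ⟨u, hu, hu'⟩ := exists_restrict_tower (E := E) hw
    exact ⟨u, hu, relIndex_decompositionGroup hu hu' (hres w hw)⟩
  refine card_decompositionGroup_dvd _ hcore hw hres N (fun w hw => ?_) (fun w hw q hq hlt => ?_)
  · obtain ⟨u, hu, h⟩ := key w hw
    exact h ▸ hN u hu
  · obtain ⟨u, hu, h⟩ := key w hw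
    rw [h]
    refine htame u hu q hq ?_
    rw [← hw.lt_one_iff, map_natCast]
    exact hlt

theorem exists_lcm_div (hu : IsExtension (algebraMap K E) v u)
    (hw : IsExtension (algebraMap E L) u w) :
    ∃ hfin : (extensions (algebraMap K E) v).Finite, ∃ r : ℕ,
      r = (hfin.toFinset.lcm fun u => ramExp (algebraMap K E) v u) / ramExp (algebraMap K E) v u ∧
      r ∣ ramExp (algebraMap E L) u w ∧
      ((∀ σ : Gal(L/K), (∀ τ, τ * σ * τ⁻¹ ∈
          (AlgEquiv.restrictScalarsHom K : Gal(L/E) →* Gal(L/K)).range) → σ = 1) →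
        (∀ w : DiscVal L, IsExtension (algebraMap K L) v w →
          ∀ x, w.1 x ≤ 1 → ∃ a : K, w.1 (x - algebraMap K L a) < 1) →
        (∀ u ∈ extensions (algebraMap K E) v, ∀ q : ℕ, q.Prime →
          v.1 (q : K) < 1 → ¬ q ∣ ramExp (algebraMap K E) v u) →
        ramExp (algebraMap E L) u w = r) := by
  have : FiniteDimensional K E := FiniteDimensional.left K E L
  have : Algebra.IsSeparable K E := Algebra.isSeparable_tower_bot_of_isSeparable K E L
  have hfin := finite_extensions E v
  set N := hfin.toFinset.lcm fun u => ramExp (algebraMap K E) v u with hN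
  have hdvd : ∀ u ∈ extensions (algebraMap K E) v, ramExp (algebraMap K E) v u ∣ N :=
    fun u hu => Finset.dvd_lcm (f := fun u => ramExp (algebraMap K E) v u)
      (hfin.mem_toFinset.2 hu)
  obtain ⟨r, hr⟩ := hdvd u hu
  have hpos := ramExp_pos hu
  have hle : N ∣ ramExp (algebraMap K L) v w :=
    Finset.lcm_dvd fun x hx => ramExp_dvd_of_isGalois (hfin.mem_toFinset.1 hx) (hu.tower hw)
  rw [hr, ramExp_tower hu hw, Nat.mul_dvd_mul_iff_left hpos] at hle
  refine ⟨hfin, r, ?_, hle, fun hcore hres htame => ?_⟩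
  · rw [← hN, hr, Nat.mul_div_cancel_left _ hpos]
  · have h := ramExp_dvd_of_tame hcore (hu.tower hw) hres N hdvd htame
    rw [hr, ramExp_tower hu hw, Nat.mul_dvd_mul_iff_left hpos] at h
    exact Nat.dvd_antisymm h hle

end Tower

/-! ### Products of exponents along the chain of fields. -/

section Chain

variable {L : Type*} [Field L]

theorem prod_ramExp_chain {t : ℕ} {K : ℕ → Subfield L} (hK : Monotone K)
    {u : ∀ i : ℕ, DiscVal (K i)}
    (hu : ∀ i, 1 ≤ i → i ≤ t →
      IsExtension (Subfield.inclusion (hK (Nat.sub_le i 1))) (u (i - 1)) (u i))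
    (s : ℕ) (hs : s ≤ t) :
    IsExtension (Subfield.inclusion (hK (Nat.zero_le s))) (u 0) (u s) ∧
      ∏ i ∈ Finset.Icc 1 s, ramExp (Subfield.inclusion (hK (Nat.sub_le i 1))) (u (i - 1)) (u i) =
        ramExp (Subfield.inclusion (hK (Nat.zero_le s))) (u 0) (u s) := by
  induction s with
  | zero =>
    have h : ∀ a, (u 0).1 (Subfield.inclusion (hK (Nat.zero_le 0)) a) = (u 0).1 a ^ 1 :=
      fun a => (pow_one _).symm
    exact ⟨isExtension_of_forall_eq_pow one_pos h, (ramExp_eq one_pos h).symm⟩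
  | succ s ih =>
    obtain ⟨h1, h2⟩ := ih (by omega)
    have h3 := hu (s + 1) (by omega) hs
    refine ⟨h1.trans h3, ?_⟩
    rw [Finset.prod_Icc_succ_top (by omega), h2]
    exact (ramExp_comp h1 h3).symm

theorem prod_ramExp_chain_mul {t : ℕ} {K : ℕ → Subfield L} (hK : Monotone K)
    {u : ∀ i : ℕ, DiscVal (K i)}
    (hu : ∀ i, 1 ≤ i → i ≤ t →
      IsExtension (Subfield.inclusion (hK (Nat.sub_le i 1))) (u (i - 1)) (u i))
    {u' : DiscVal L} (hu' : IsExtension (K t).subtype (u t) u') :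
    IsExtension (K 0).subtype (u 0) u' ∧
      (∏ i ∈ Finset.Icc 1 t,
        ramExp (Subfield.inclusion (hK (Nat.sub_le i 1))) (u (i - 1)) (u i)) *
          ramExp (K t).subtype (u t) u' = ramExp (K 0).subtype (u 0) u' := by
  obtain ⟨h1, h2⟩ := prod_ramExp_chain hK hu t le_rfl
  rw [h2]
  exact ⟨h1.trans hu', (ramExp_comp h1 hu').symm⟩

end Chain

theorem natCast_eq_zero_residue {F : Type*} [Field F] {v : DiscVal F} {q : ℕ}
    (h : v.1 (q : F) < 1) : (q : v.Residue) = 0 := by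
  rw [← map_natCast (IsLocalRing.residue v.1.valuationSubring) q, IsLocalRing.residue_eq_zero_iff,
    mem_maximalIdeal_iff]
  simpa using h

end DiscVal

/-! ### `L` as a splitting field at every level of the chain. -/

section Chain

variable {L : Type u} [Field L] {t : ℕ} {K : ℕ → Subfield L} {f g : ∀ i : ℕ, (K i)[X]} {α : ℕ → L}

theorem splits_of_chain (hfg : ∀ i ≤ t, Relation.TransGen RootTransform (f i) (g i))
    (hthrow : ∀ i, 1 ≤ i → i ≤ t →
      (g (i - 1)).map (K (i - 1)).subtype = (X - C (α i)) * (f i).map (K i).subtype)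
    (hs : ((g t).map (K t).subtype).Splits) (i : ℕ) (hi : i ≤ t) :
    ((f i).map (K i).subtype).Splits := by
  induction hn : t - i generalizing i with
  | zero =>
    obtain rfl : i = t := by omega
    exact (RootTransform.splits_map_iff_of_transGen _ (hfg i hi)).1 hs
  | succ n ih =>
    have h1 := ih (i + 1) (by omega) (by omega)
    have h2 := hthrow (i + 1) (by omega) (by omega)
    refine (RootTransform.splits_map_iff_of_transGen _ (hfg i hi)).1 ?_
    have h3 : (g i).map (K i).subtype =
      (X - C (α (i + 1))) * (f (i + 1)).map (K (i + 1)).subtype := h2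
    rw [h3]
    exact (Splits.X_sub_C _).mul h1

/-- Going up from level `s`, `M` absorbs each discarded root and hence each `K i`, and at the end
all roots of `g t`, which generate `L` over `K t`. -/
theorem eq_top_of_chain (hg : ∀ i ≤ t, (g i).Monic)
    (hfg : ∀ i ≤ t, Relation.TransGen RootTransform (f i) (g i))
    (hthrow : ∀ i, 1 ≤ i → i ≤ t →
      (g (i - 1)).map (K (i - 1)).subtype = (X - C (α i)) * (f i).map (K i).subtype)
    (hadj : ∀ i, 1 ≤ i → i ≤ t → K i = (K (i - 1))⟮α i⟯.toSubfield)
    (hL : (g t).IsSplittingField (K t) L) {s : ℕ} (hst : s ≤ t) (M : Subfield L)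
    (hM : K s ≤ M) (hs : ((f s).map (Subfield.inclusion hM)).Splits) : M = ⊤ := by
  have key : ∀ i, s ≤ i → i ≤ t → ∃ h : K i ≤ M, ((f i).map (Subfield.inclusion h)).Splits := by
    intro i hsi
    induction i, hsi using Nat.le_induction with
    | base => exact fun _ => ⟨hM, hs⟩
    | succ i hsi ih =>
      intro hi
      obtain ⟨h, hf⟩ := ih (by omega)
      exact splits_of_throw_root h (hg i (by omega)) (hadj (i + 1) (by omega) hi)
        (hthrow (i + 1) (by omega) hi)
        ((RootTransform.splits_map_iff_of_transGen _ (hfg i (by omega))).2 hf)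
  obtain ⟨h, hf⟩ := key t hst le_rfl
  have hgM := (RootTransform.splits_map_iff_of_transGen _ (hfg t le_rfl)).2 hf
  have hadj' := IsSplittingField.adjoin_rootSet L (g t)
  rw [eq_top_iff]
  intro x _
  have hx : x ∈ Algebra.adjoin (K t) ((g t).rootSet L) := hadj' ▸ Algebra.mem_top
  induction hx using Algebra.adjoin_induction with
  | mem x hx =>
    have hroot : (((g t).map (Subfield.inclusion h)).map M.subtype).IsRoot x := by
      have := (mem_rootSet.1 hx).2
      rw [Polynomial.map_map]
      change ((g t).map (algebraMap (K t) L)).IsRoot x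
      rwa [IsRoot.def, eval_map_algebraMap]
    obtain ⟨a, rfl⟩ := hgM.mem_range_of_isRoot ((hg t le_rfl).map _).ne_zero hroot
    exact a.2
  | algebraMap a => exact h a.2
  | add x y _ _ hx hy => exact M.add_mem (hx trivial) (hy trivial)
  | mul x y _ _ hx hy => exact M.mul_mem (hx trivial) (hy trivial)

/-- The polynomial `q` stands for either `f s` or `g s`; only its splitting behaviour matters. -/
theorem isSplittingField_of_chain (hg : ∀ i ≤ t, (g i).Monic)
    (hfg : ∀ i ≤ t, Relation.TransGen RootTransform (f i) (g i))
    (hthrow : ∀ i, 1 ≤ i → i ≤ t →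
      (g (i - 1)).map (K (i - 1)).subtype = (X - C (α i)) * (f i).map (K i).subtype)
    (hadj : ∀ i, 1 ≤ i → i ≤ t → K i = (K (i - 1))⟮α i⟯.toSubfield)
    (hL : (g t).IsSplittingField (K t) L) {s : ℕ} (hst : s ≤ t) {q : (K s)[X]}
    (hq : ∀ {E : Type u} [Field E] (φ : K s →+* E), (q.map φ).Splits ↔ ((f s).map φ).Splits) :
    q.IsSplittingField (K s) L := by
  have hs : (q.map (algebraMap (K s) L)).Splits :=
    (hq _).2 (splits_of_chain hfg hthrow (IsSplittingField.splits L (g t)) s hst)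
  rw [isSplittingField_iff_intermediateField]
  refine ⟨hs, ?_⟩
  set M := IntermediateField.adjoin (K s) (q.rootSet L)
  have hM : K s ≤ M.toSubfield := fun a ha => M.algebraMap_mem ⟨a, ha⟩
  have hsM : (q.map (algebraMap (K s) M)).Splits :=
    IntermediateField.splits_of_splits hs fun x hx => IntermediateField.subset_adjoin _ _ hx
  have := eq_top_of_chain hg hfg hthrow hadj hL hst M.toSubfield hM ((hq _).1 hsM)
  rw [eq_top_iff]
  intro x _
  change x ∈ M.toSubfield
  rw [this]
  trivial

end Chain

/-- By irreducibility the group is transitive on the roots, so such a `σ` fixes all of them. This is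
the trivial core condition in Abhyankar's lemma. -/
theorem eq_one_of_forall_conj_fixes_root {F L : Type*} [Field F] [Field L] [Algebra F L]
    {q : F[X]} [IsGalois F L] [q.IsSplittingField F L] (hq : Irreducible q) {α : L}
    (hα : aeval α q = 0) {σ : Gal(L/F)} (hσ : ∀ τ : Gal(L/F), (τ * σ * τ⁻¹) α = α) : σ = 1 := by
  have h1 : (σ : L →ₐ[F] L) = AlgHom.id F L := by
    refine AlgHom.ext_of_adjoin_eq_top (IsSplittingField.adjoin_rootSet L q) fun x hx => ?_
    have hαint : IsAlgebraic F α := ⟨q, hq.ne_zero, hα⟩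
    obtain ⟨τ, hτ⟩ := minpoly.exists_algEquiv_of_root (K := F) (x := x) hαint (by
      rw [← minpoly.eq_of_irreducible hq hα, map_mul, (mem_rootSet.1 hx).2, zero_mul])
    have h2 : τ (σ (τ⁻¹ α)) = α := hσ τ
    have h3 : τ⁻¹ α = x := by
      rw [← hτ]
      exact τ.symm_apply_apply x
    rw [h3, ← hτ] at h2
    exact τ.injective h2
  exact AlgEquiv.ext fun x => DFunLike.congr_fun h1 x

/-- The fields `K 0 ⊆ K 1 ⊆ ⋯ ⊆ K t` are realised inside the splitting field `L` of `g t` over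
`K t`; only the indices `0, …, t` (for `α`: `1, …, t`) are relevant. -/
theorem mainTheorem9 {L : Type*} [Field L] (p t : ℕ) (hp : p.Prime) (ht : 0 < t)
    (K : ℕ → Subfield L) (hK : Monotone K)
    (f g : ∀ i : ℕ, (K i)[X]) (α : ℕ → L)
    (hf : ∀ i ≤ t, (f i).Monic ∧ (f i).natDegree = p + t - i)
    (hg : ∀ i ≤ t, (g i).Monic ∧ (g i).natDegree = p + t - i)
    -- `g i` arises from `f i` by one or more transformations of the roots
    (hfg : ∀ i ≤ t, Relation.TransGen RootTransform (f i) (g i))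
    -- `f i` arises from `g (i - 1)` by throwing away the root `α i`, and `K i = K (i - 1) (α i)`
    (hthrow : ∀ i, 1 ≤ i → i ≤ t →
      (g (i - 1)).map (K (i - 1)).subtype = (X - C (α i)) * (f i).map (K i).subtype)
    (hadj : ∀ i, 1 ≤ i → i ≤ t → K i = (K (i - 1))⟮α i⟯.toSubfield)
    (hsep : (f 0).Separable)
    (hL : (g t).IsSplittingField (K t) L)
    -- the chain that is prime to `p` at every step, and the chain divisible by `p` at some step
    (uhat u : ∀ i : ℕ, DiscVal (K i)) (hu0 : uhat 0 = u 0)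
    (huhat : ∀ i, 1 ≤ i → i ≤ t →
      DiscVal.IsExtension (Subfield.inclusion (hK (Nat.sub_le i 1))) (uhat (i - 1)) (uhat i))
    (hu : ∀ i, 1 ≤ i → i ≤ t →
      DiscVal.IsExtension (Subfield.inclusion (hK (Nat.sub_le i 1))) (u (i - 1)) (u i))
    (hram_uhat : ∀ i, 1 ≤ i → i ≤ t → ¬ p ∣
      DiscVal.ramExp (Subfield.inclusion (hK (Nat.sub_le i 1))) (uhat (i - 1)) (uhat i))
    (hram_u : ∃ j, 1 ≤ j ∧ j ≤ t ∧ p ∣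
      DiscVal.ramExp (Subfield.inclusion (hK (Nat.sub_le j 1))) (u (j - 1)) (u j))
    (u' : DiscVal L) (hu' : DiscVal.IsExtension (K t).subtype (u t) u') :
    Irreducible (g t) ∧
    DiscVal.ramExp (K t).subtype (u t) u' ∣ Nat.card (g t).Gal ∧
    -- the extensions of `u (t - 1)` to `K t` are finite in number, which defines `r''`
    (∃ hfin : (DiscVal.extensions
        (Subfield.inclusion (hK (Nat.sub_le t 1))) (u (t - 1))).Finite,
      ∃ r'' : ℕ,
        r'' = (hfin.toFinset.lcm fun w =>
            DiscVal.ramExp (Subfield.inclusion (hK (Nat.sub_le t 1))) (u (t - 1)) w) /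
          DiscVal.ramExp (Subfield.inclusion (hK (Nat.sub_le t 1))) (u (t - 1)) (u t) ∧
        r'' ∣ DiscVal.ramExp (K t).subtype (u t) u' ∧
        (Irreducible (g (t - 1)) →
          IsAlgClosed (u 0).Residue →
          ringChar (u 0).Residue = ringChar (K 0) →
          (∀ w ∈ DiscVal.extensions (Subfield.inclusion (hK (Nat.sub_le t 1))) (u (t - 1)),
            ¬ ringChar (K 0) ∣
              DiscVal.ramExp (Subfield.inclusion (hK (Nat.sub_le t 1))) (u (t - 1)) w) →
          DiscVal.ramExp (K t).subtype (u t) u' = r'')) ∧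
    -- any other chain starting from `u 0` has the same total ramification exponent
    (∀ (ubar : ∀ i : ℕ, DiscVal (K i)) (ubar' : DiscVal L), ubar 0 = u 0 →
      (∀ i, 1 ≤ i → i ≤ t →
        DiscVal.IsExtension (Subfield.inclusion (hK (Nat.sub_le i 1))) (ubar (i - 1)) (ubar i)) →
      DiscVal.IsExtension (K t).subtype (ubar t) ubar' →
      (∏ i ∈ Finset.Icc 1 t,
          DiscVal.ramExp (Subfield.inclusion (hK (Nat.sub_le i 1))) (ubar (i - 1)) (ubar i)) *
          DiscVal.ramExp (K t).subtype (ubar t) ubar' =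
        (∏ i ∈ Finset.Icc 1 t,
          DiscVal.ramExp (Subfield.inclusion (hK (Nat.sub_le i 1))) (u (i - 1)) (u i)) *
          DiscVal.ramExp (K t).subtype (u t) u') := by
  have hgm : ∀ i ≤ t, (g i).Monic := fun i hi => (hg i hi).1
  have hsplit0 : (f 0).IsSplittingField (K 0) L :=
    isSplittingField_of_chain hgm hfg hthrow hadj hL (Nat.zero_le t) fun _ => Iff.rfl
  have hgal0 : IsGalois (K 0) L := IsGalois.of_separable_splitting_field hsep
  have hfd0 : FiniteDimensional (K 0) L := IsSplittingField.finiteDimensional L (f 0)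
  have hgal : ∀ i, IsGalois (K i) L ∧ FiniteDimensional (K i) L := by
    intro i
    let : Algebra (K 0) (K i) := (Subfield.inclusion (hK (Nat.zero_le i))).toAlgebra
    have : IsScalarTower (K 0) (K i) L := .of_algebraMap_eq fun _ => rfl
    exact ⟨IsGalois.tower_top_of_isGalois (K 0) (K i) L, FiniteDimensional.right (K 0) (K i) L⟩
  obtain ⟨hgalt, hfdt⟩ := hgal t
  obtain ⟨hgals, hfds⟩ := hgal (t - 1)
  have htotal := DiscVal.prod_ramExp_chain_mul hK hu hu'
  have hsame : ∀ (ubar : ∀ i : ℕ, DiscVal (K i)) (ubar' : DiscVal L), ubar 0 = u 0 →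
      (∀ i, 1 ≤ i → i ≤ t →
        DiscVal.IsExtension (Subfield.inclusion (hK (Nat.sub_le i 1))) (ubar (i - 1)) (ubar i)) →
      DiscVal.IsExtension (K t).subtype (ubar t) ubar' →
      (∏ i ∈ Finset.Icc 1 t,
          DiscVal.ramExp (Subfield.inclusion (hK (Nat.sub_le i 1))) (ubar (i - 1)) (ubar i)) *
          DiscVal.ramExp (K t).subtype (ubar t) ubar' =
        (∏ i ∈ Finset.Icc 1 t,
          DiscVal.ramExp (Subfield.inclusion (hK (Nat.sub_le i 1))) (u (i - 1)) (u i)) *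
          DiscVal.ramExp (K t).subtype (u t) u' := by
    intro ubar ubar' h0 hubar hubar'
    have htotal' := DiscVal.prod_ramExp_chain_mul hK hubar hubar'
    rw [htotal.2, htotal'.2]
    rw [h0] at htotal' ⊢
    exact DiscVal.ramExp_eq_of_isGalois (K := K 0) htotal'.1 htotal.1
  have hirr : Irreducible (g t) := by
    -- Extending the chain `uhat` to `L` allows its total exponent to be compared with that of `u`.
    obtain ⟨w, hw⟩ := DiscVal.exists_isExtension L (uhat t)
    have h1 := hsame uhat w hu0 huhat hw
    obtain ⟨j, hj1, hjt, hj⟩ := hram_u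
    have h2 : p ∣ (∏ i ∈ Finset.Icc 1 t,
          DiscVal.ramExp (Subfield.inclusion (hK (Nat.sub_le i 1))) (u (i - 1)) (u i)) *
          DiscVal.ramExp (K t).subtype (u t) u' :=
      (hj.trans (Finset.dvd_prod_of_mem (fun i => DiscVal.ramExp
        (Subfield.inclusion (hK (Nat.sub_le i 1))) (u (i - 1)) (u i))
        (Finset.mem_Icc.2 ⟨hj1, hjt⟩))).mul_right _
    rw [← h1] at h2
    have h3 : p ∣ DiscVal.ramExp (algebraMap (K t) L) (uhat t) w := by
      refine (hp.dvd_mul.1 h2).resolve_left fun h => ?_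
      obtain ⟨i, hi, hdvd⟩ := (Prime.dvd_finsetProd_iff hp.prime _).1 h
      exact hram_uhat i (Finset.mem_Icc.1 hi).1 (Finset.mem_Icc.1 hi).2 hdvd
    exact irreducible_of_prime_dvd_card_gal (L := L) hp (hgm t le_rfl)
      ((hg t le_rfl).2.trans (Nat.add_sub_cancel p t)) (h3.trans (DiscVal.ramExp_dvd_card hw))
  refine ⟨hirr, ?_, ?_, hsame⟩
  · have h1 : Nat.card (g t).Gal = Nat.card Gal(L/K t) :=
      Nat.card_congr (IsSplittingField.algEquiv L (g t)).symm.autCongr.toEquiv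
    rw [h1]
    exact DiscVal.ramExp_dvd_card (K := K t) hu'
  · let : Algebra (K (t - 1)) (K t) := (Subfield.inclusion (hK (Nat.sub_le t 1))).toAlgebra
    have : IsScalarTower (K (t - 1)) (K t) L := .of_algebraMap_eq fun _ => rfl
    have hut := hu t ht le_rfl
    obtain ⟨hfin, r, hr, hdvd, hlast⟩ := DiscVal.exists_lcm_div (K := K (t - 1)) (E := K t) (L := L) hut hu'
    refine ⟨hfin, r, hr, hdvd, fun hirr' halg hchar htame => hlast ?_ ?_ ?_⟩
    · have hsplit : (g (t - 1)).IsSplittingField (K (t - 1)) L :=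
        isSplittingField_of_chain hgm hfg hthrow hadj hL (Nat.sub_le t 1) fun φ =>
          RootTransform.splits_map_iff_of_transGen φ (hfg (t - 1) (Nat.sub_le t 1))
      have hα : aeval (α t) (g (t - 1)) = 0 := by
        have h1 : (g (t - 1)).map (algebraMap (K (t - 1)) L) = _ := hthrow t ht le_rfl
        rw [← eval_map_algebraMap, h1]
        simp
      have hαt : α t ∈ K t := by
        rw [hadj t ht le_rfl]
        exact IntermediateField.mem_adjoin_simple_self _ _
      intro σ hσ
      refine eq_one_of_forall_conj_fixes_root hirr' hα fun τ => ?_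
      obtain ⟨ρ, hρ⟩ := hσ τ
      rw [← hρ]
      exact ρ.commutes ⟨α t, hαt⟩
    · intro w hw x hx
      have hchain := (DiscVal.prod_ramExp_chain hK hu (t - 1) (Nat.sub_le t 1)).1
      -- Representatives already exist in `K 0`, whose residue field is algebraically closed.
      obtain ⟨a, ha⟩ := DiscVal.exists_residue_of_isAlgClosed (K := K 0) (hchain.trans hw) halg x hx
      exact ⟨Subfield.inclusion (hK (Nat.zero_le _)) a, ha⟩
    · intro w hw q hq hlt hqdvd
      have hchain := (DiscVal.prod_ramExp_chain hK hu (t - 1) (Nat.sub_le t 1)).1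
      have h1 : (u 0).1 (q : K 0) < 1 := by
        rw [← hchain.lt_one_iff, map_natCast]
        exact hlt
      -- A prime of value below 1 must be the residue characteristic, which equals that of `K 0`.
      have h2 : ringChar (u 0).Residue ∣ q := ringChar.dvd (DiscVal.natCast_eq_zero_residue h1)
      have h3 : ringChar (u 0).Residue = q :=
        ((Nat.dvd_prime hq).1 h2).resolve_left (CharP.ringChar_ne_one)
      refine htame w hw ?_
      rw [← hchar, h3]
      exact hqdvd
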